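/- Let $q$ be an indeterminate. Put $(q;q)_n=\prod_{i=1}^{n}(1-q^i)$ for $n\ge 0$ (so $(q;q)_0=1$) and $(q;q)_\infty=\prod_{i\ge 1}(1-q^i)$. Then, in the ring $\mathbb{Z}[[q]]$ of formal power series with its coefficientwise (equivalently, $q$-adic) notion of convergence, both sums below converge and $$\sum_{n\ge 0}\frac{q^{n^2}}{(q;q)_{2n}}=\frac{1}{(q;q)_\infty}\sum_{k\in\mathbb{Z}}\left(q^{15k^2+k}-q^{15k^2+11k+2}\right).$$ -/

import Mathlib

open PowerSeries
open scoped PowerSeries.WithPiTopology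

/-- The finite product `(q; q)_n = (1 - q)(1 - q²) ⋯ (1 - qⁿ)` in `ℤ⟦q⟧`, with `q = X`. -/
noncomputable def qPoch (n : ℕ) : ℤ⟦X⟧ :=
  ∏ i ∈ Finset.range n, (1 - X ^ (i + 1))

/-- The infinite product `(q; q)_∞ = (1 - q)(1 - q²)(1 - q³) ⋯` in `ℤ⟦q⟧`; it converges
coefficientwise, see `multipliable_qPochInf`. -/
noncomputable def qPochInf : ℤ⟦X⟧ :=
  ∏' i : ℕ, (1 - X ^ (i + 1))

theorem multipliable_qPochInf : Multipliable fun i : ℕ => (1 : ℤ⟦X⟧) - X ^ (i + 1) :=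
  PowerSeries.WithPiTopology.multipliable_one_sub_X_pow ℤ

theorem constantCoeff_qPoch (n : ℕ) : constantCoeff (qPoch n) = 1 := by
  simp [qPoch]

theorem constantCoeff_qPochInf : constantCoeff qPochInf = 1 := by
  simp [qPochInf, multipliable_qPochInf.map_tprod _
    (PowerSeries.WithPiTopology.continuous_constantCoeff ℤ)]

/-- The reciprocal `1 / f` of an integer power series `f` with constant coefficient `1`. -/
noncomputable def recip (f : ℤ⟦X⟧) : ℤ⟦X⟧ :=
  PowerSeries.invOfUnit f 1

theorem mul_recip (f : ℤ⟦X⟧) (hf : constantCoeff f = 1) : f * recip f = 1 :=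
  PowerSeries.mul_invOfUnit f 1 (by simpa using hf)

/-- `q ^ e` for an integer exponent `e`; used only for `e ≥ 0`, see `thetaExp_nonneg`. -/
noncomputable def qPow (e : ℤ) : ℤ⟦X⟧ :=
  X ^ e.toNat

theorem thetaExp_nonneg (k : ℤ) : 0 ≤ 15 * k ^ 2 + k ∧ 0 ≤ 15 * k ^ 2 + 11 * k + 2 := by
  rcases le_or_gt 0 k with h | h
  · constructor <;> positivity
  · have h1 : k ≤ -1 := by omega
    constructor <;> nlinarith

/-! ### Infinite sums of power series whose terms are divisible by growing powers of `X` -/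

/-! The proof inserts a Bailey pair into a Durfee rectangle identity. By `baileySum_eq`,
1/(q;q)_(2n) is a sum over r of α_r / ((q;q)_(n-r) (q;q)_(n+r)), where α_r = q^(6k²+k) for r = 3k,
α_r = -q^(6k²+5k+1) for r = 3k+1, and α_r = 0 otherwise. By `tsum_X_pow_sq_mul_recipPoch`, weighting
1/((q;q)_(n-r) (q;q)_(n+r)) by q^(n²) and summing over n gives q^(r²)/(q;q)_∞. Interchanging the two
sums leaves Σ α_r q^(r²)/(q;q)_∞, whose exponents are 6k²+k+(3k)² and 6k²+5k+1+(3k+1)². -/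

theorem summable_of_X_pow_dvd {ι : Type*} {f : ι → ℤ⟦X⟧} (g : ι → ℕ)
    (hg : ∀ d, {i | g i ≤ d}.Finite) (h : ∀ i, X ^ g i ∣ f i) : Summable f := by
  rw [PowerSeries.WithPiTopology.summable_iff_summable_coeff]
  intro d
  refine summable_of_hasFiniteSupport ((hg d).subset fun i hi => ?_)
  by_contra hlt
  exact hi (PowerSeries.X_pow_dvd_iff.1 (h i) d (not_le.1 hlt))

theorem summable_nat_of_X_pow_dvd {f : ℕ → ℤ⟦X⟧} (h : ∀ n, X ^ n ∣ f n) : Summable f :=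
  summable_of_X_pow_dvd id (fun d => Set.finite_Iic d) h

theorem finite_setOf_natAbs_le (d : ℕ) : {k : ℤ | k.natAbs ≤ d}.Finite :=
  (Set.finite_Icc (-(d : ℤ)) d).subset fun k (hk : k.natAbs ≤ d) => by
    constructor <;> omega

theorem summable_int_of_X_pow_dvd {f : ℤ → ℤ⟦X⟧} (h : ∀ k, X ^ k.natAbs ∣ f k) : Summable f :=
  summable_of_X_pow_dvd Int.natAbs finite_setOf_natAbs_le h

theorem summable_nat_prod_int_of_X_pow_dvd {f : ℕ × ℤ → ℤ⟦X⟧}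
    (h : ∀ p, X ^ (p.1 + p.2.natAbs) ∣ f p) : Summable f := by
  refine summable_of_X_pow_dvd (fun p : ℕ × ℤ => p.1 + p.2.natAbs) (fun d => ?_) h
  refine ((Set.finite_Iic d).prod (finite_setOf_natAbs_le d)).subset fun p hp => ?_
  simp only [Set.mem_ofPred_eq] at hp
  simp only [Set.mem_prod, Set.mem_Iic, Set.mem_ofPred_eq]
  omega

theorem X_pow_dvd_tsum {ι : Type*} {f : ι → ℤ⟦X⟧} {d : ℕ} (hf : Summable f)
    (h : ∀ i, X ^ d ∣ f i) : X ^ d ∣ ∑' i, f i := by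
  rw [PowerSeries.X_pow_dvd_iff]
  intro m hm
  rw [hf.map_tsum (coeff m : ℤ⟦X⟧ →ₗ[ℤ] ℤ) (PowerSeries.WithPiTopology.continuous_coeff ℤ m)]
  simp [fun i => PowerSeries.X_pow_dvd_iff.1 (h i) m hm]

theorem tendsto_zero_of_X_pow_dvd {f : ℕ → ℤ⟦X⟧} (h : ∀ n, X ^ n ∣ f n) :
    Filter.Tendsto f Filter.atTop (nhds 0) := by
  rw [PowerSeries.WithPiTopology.tendsto_iff_coeff_tendsto]
  intro d
  refine tendsto_const_nhds.congr' ?_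
  filter_upwards [Filter.eventually_gt_atTop d] with n hn
  rw [PowerSeries.X_pow_dvd_iff.1 (h n) d hn, map_zero]

theorem eq_zero_of_forall_X_pow_dvd {f : ℤ⟦X⟧} (h : ∀ n : ℕ, X ^ n ∣ f) : f = 0 := by
  ext d
  simpa using PowerSeries.X_pow_dvd_iff.1 (h (d + 1)) d (Nat.lt_succ_self d)

/-! ### Reciprocals of the finite products -/

theorem qPoch_succ (n : ℕ) : qPoch (n + 1) = qPoch n * (1 - X ^ (n + 1)) :=
  Finset.prod_range_succ _ _

theorem qPoch_mul_recip (n : ℕ) : qPoch n * recip (qPoch n) = 1 :=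
  mul_recip _ (constantCoeff_qPoch n)

theorem recip_eq_of_mul_eq_one {f g : ℤ⟦X⟧} (hf : constantCoeff f = 1) (h : f * g = 1) :
    recip f = g := by
  linear_combination (recip f) * (-h) + g * mul_recip f hf

theorem recip_qPoch_zero : recip (qPoch 0) = 1 :=
  recip_eq_of_mul_eq_one (constantCoeff_qPoch 0) (by simp [qPoch])

theorem one_sub_mul_recip_qPoch_succ (n : ℕ) :
    (1 - X ^ (n + 1)) * recip (qPoch (n + 1)) = recip (qPoch n) := by
  refine (recip_eq_of_mul_eq_one (constantCoeff_qPoch n) ?_).symm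
  rw [← mul_assoc, ← qPoch_succ, qPoch_mul_recip]

/-! ### The Durfee rectangle identity -/

/-- The sum `∑ₘ q^(m² + ms) / ((q; q)_m (q; q)_(m+s))` over Durfee rectangles `m × (m + s)`. -/
noncomputable def durfeeSum (s : ℕ) : ℤ⟦X⟧ :=
  ∑' m : ℕ, X ^ (m ^ 2 + m * s) * (recip (qPoch m) * recip (qPoch (m + s)))

theorem summable_X_pow_sq_mul (s : ℕ) (f : ℕ → ℤ⟦X⟧) :
    Summable fun m : ℕ => X ^ (m ^ 2 + m * s) * f m :=
  summable_nat_of_X_pow_dvd fun m =>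
    (pow_dvd_pow X (le_add_right (Nat.le_self_pow two_ne_zero m))).mul_right _

/-- Both differences are compared with the mixed sum `H`. Expanding 1/(q;q)_(m+s) as
(1-q^(m+s+1))/(q;q)_(m+s+1) gives the first relation. In the second, the factor 1-q^m kills m = 0
and the shift m → m+1 produces the parameter s+2. -/
theorem durfeeSum_sub_durfeeSum_succ (s : ℕ) :
    durfeeSum s - durfeeSum (s + 1) =
      -(X ^ (s + 1) * (durfeeSum (s + 1) - durfeeSum (s + 2))) := by
  set H : ℤ⟦X⟧ := ∑' m : ℕ, X ^ (m ^ 2 + m * s) * (recip (qPoch m) * recip (qPoch (m + s + 1)))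
    with hH
  have h1 : durfeeSum s = H - X ^ (s + 1) * durfeeSum (s + 1) := by
    rw [hH, durfeeSum, durfeeSum, ← (summable_X_pow_sq_mul _ _).tsum_mul_left,
      ← (summable_X_pow_sq_mul _ _).tsum_sub ((summable_X_pow_sq_mul _ _).mul_left _)]
    refine tsum_congr fun m => ?_
    rw [← one_sub_mul_recip_qPoch_succ (m + s), ← add_assoc m s 1]
    ring
  have h2 : H - durfeeSum (s + 1) = X ^ (s + 1) * durfeeSum (s + 2) := by
    have hs : Summable fun m : ℕ =>
        X ^ (m ^ 2 + m * s) * (recip (qPoch m) * recip (qPoch (m + s + 1))) -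
        X ^ (m ^ 2 + m * (s + 1)) * (recip (qPoch m) * recip (qPoch (m + (s + 1)))) :=
      (summable_X_pow_sq_mul _ _).sub (summable_X_pow_sq_mul _ _)
    rw [hH, durfeeSum, durfeeSum, ← (summable_X_pow_sq_mul _ _).tsum_mul_left,
      ← (summable_X_pow_sq_mul _ _).tsum_sub (summable_X_pow_sq_mul _ _), hs.tsum_eq_zero_add]
    simp only [zero_add, zero_mul, ne_eq, OfNat.ofNat_ne_zero, not_false_eq_true, zero_pow,
      sub_self]
    refine tsum_congr fun m => ?_
    rw [← one_sub_mul_recip_qPoch_succ m, show m + 1 + s + 1 = m + (s + 2) by ring,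
      show m + 1 + (s + 1) = m + (s + 2) by ring]
    ring
  linear_combination h1 + h2

/-- Each use of the recurrence gains a factor of positive order, so the difference is divisible by
every power of q. -/
theorem durfeeSum_succ (s : ℕ) : durfeeSum (s + 1) = durfeeSum s := by
  have h : ∀ n s : ℕ, X ^ n ∣ durfeeSum s - durfeeSum (s + 1) := by
    intro n
    induction n with
    | zero => simp
    | succ n ih =>
      intro s
      rw [durfeeSum_sub_durfeeSum_succ, dvd_neg, pow_succ']
      exact mul_dvd_mul (dvd_pow_self X s.succ_ne_zero) (ih (s + 1))
  exact (sub_eq_zero.1 (eq_zero_of_forall_X_pow_dvd fun n => h n s)).symm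

theorem durfeeSum_eq_durfeeSum_zero (s : ℕ) : durfeeSum s = durfeeSum 0 := by
  induction s with
  | zero => rfl
  | succ s ih => rw [durfeeSum_succ, ih]

theorem X_pow_dvd_qPoch_mul_durfeeSum_sub_one (s : ℕ) :
    X ^ s ∣ qPoch s * durfeeSum s - 1 := by
  have h : durfeeSum s = recip (qPoch s) + ∑' m : ℕ, X ^ ((m + 1) ^ 2 + (m + 1) * s) *
      (recip (qPoch (m + 1)) * recip (qPoch (m + 1 + s))) := by
    rw [durfeeSum, (summable_X_pow_sq_mul _ _).tsum_eq_zero_add]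
    simp [recip_qPoch_zero]
  rw [h, mul_add, qPoch_mul_recip, add_sub_cancel_left]
  refine (X_pow_dvd_tsum ?_ fun m => ?_).mul_left _
  · exact (summable_nat_add_iff 1).2 (summable_X_pow_sq_mul s
      fun m => recip (qPoch m) * recip (qPoch (m + s)))
  · exact (pow_dvd_pow X (by nlinarith)).mul_right _

/-- Since the sum does not depend on s, it can be evaluated as s → ∞, where only the m = 0 term
1/(q;q)_s survives. -/
theorem durfeeSum_eq (s : ℕ) : durfeeSum s = recip qPochInf := by
  rw [durfeeSum_eq_durfeeSum_zero]
  refine (recip_eq_of_mul_eq_one constantCoeff_qPochInf ?_).symm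
  have h1 : Filter.Tendsto (fun s => qPoch s * durfeeSum 0 - 1) Filter.atTop
      (nhds (qPochInf * durfeeSum 0 - 1)) :=
    (multipliable_qPochInf.hasProd.tendsto_prod_nat.mul_const _).sub_const _
  have h2 : Filter.Tendsto (fun s => qPoch s * durfeeSum 0 - 1) Filter.atTop (nhds 0) :=
    tendsto_zero_of_X_pow_dvd fun s => by
      simpa [durfeeSum_eq_durfeeSum_zero s] using X_pow_dvd_qPoch_mul_durfeeSum_sub_one s
  exact sub_eq_zero.1 (tendsto_nhds_unique h1 h2)

/-! ### Integer indices -/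

/-- `1 / (q; q)_i` for an integer index `i`, with the convention that it is `0` for `i < 0`. -/
noncomputable def recipPoch (i : ℤ) : ℤ⟦X⟧ :=
  if 0 ≤ i then recip (qPoch i.toNat) else 0

theorem recipPoch_natCast (n : ℕ) : recipPoch n = recip (qPoch n) := by
  simp [recipPoch]

theorem recipPoch_of_neg {i : ℤ} (h : i < 0) : recipPoch i = 0 :=
  if_neg (not_le.2 h)

/-- The zero convention is consistent at i = 0 because 1-q^0 = 0, so bilateral sums need no boundary
terms. -/
theorem recipPoch_sub_one (i : ℤ) : recipPoch (i - 1) = (1 - qPow i) * recipPoch i := by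
  rcases lt_trichotomy i 0 with h | rfl | h
  · rw [recipPoch_of_neg h, recipPoch_of_neg (by omega), mul_zero]
  · rw [recipPoch_of_neg (by omega)]
    simp [qPow]
  · obtain ⟨n, rfl⟩ : ∃ n : ℕ, i = (n + 1 : ℕ) := ⟨(i - 1).toNat, by omega⟩
    rw [show ((n + 1 : ℕ) : ℤ) - 1 = n by push_cast; ring, recipPoch_natCast, recipPoch_natCast,
      ← one_sub_mul_recip_qPoch_succ, qPow, Int.toNat_natCast]

theorem qPow_add {a b : ℤ} (ha : 0 ≤ a) (hb : 0 ≤ b) : qPow (a + b) = qPow a * qPow b := by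
  rw [qPow, qPow, qPow, Int.toNat_add ha hb, pow_add]

/-- `qPow` truncates negative exponents, so exponents need not add when b < 0; there the factor
`recipPoch b` is zero. -/
theorem qPow_mul_qPow_mul_recipPoch {a : ℤ} (ha : 0 ≤ a) (b : ℤ) :
    qPow a * (qPow b * recipPoch b) = qPow (a + b) * recipPoch b := by
  rcases lt_or_ge b 0 with h | h
  · simp [recipPoch_of_neg h]
  · rw [qPow_add ha h, mul_assoc]

/-- The `q`-Pascal recurrence for `1 / ((q; q)_a (q; q)_b)`. -/
theorem one_sub_qPow_mul_recipPoch_mul (a b : ℤ) :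
    (1 - qPow (a + b)) * (recipPoch a * recipPoch b) =
      recipPoch a * recipPoch (b - 1) + qPow b * (recipPoch (a - 1) * recipPoch b) := by
  rcases lt_or_ge a 0 with ha | ha
  · simp [recipPoch_of_neg ha, recipPoch_of_neg (show a - 1 < 0 by omega)]
  rcases lt_or_ge b 0 with hb | hb
  · simp [recipPoch_of_neg hb, recipPoch_of_neg (show b - 1 < 0 by omega)]
  -- The identity behind this is 1-q^(a+b) = (1-q^b) + q^b (1-q^a).
  rw [recipPoch_sub_one, recipPoch_sub_one, qPow_add ha hb]
  ring

/-- Terms with n < r vanish. Putting n = m+r, the exponent becomes m²+m(2r)+r², which is the Durfee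
sum with s = 2r. -/
theorem tsum_X_pow_sq_mul_recipPoch_natCast (r : ℕ) :
    ∑' n : ℕ, X ^ (n ^ 2) * (recipPoch (n - r) * recipPoch (n + r)) =
      X ^ (r ^ 2) * recip qPochInf := by
  rw [← durfeeSum_eq (2 * r), durfeeSum, ← (summable_X_pow_sq_mul _ _).tsum_mul_left,
    ← (add_left_injective r).tsum_eq]
  · refine tsum_congr fun m => ?_
    rw [show ((m + r : ℕ) : ℤ) - r = m by push_cast; ring,
      show ((m + r : ℕ) : ℤ) + r = (m + 2 * r : ℕ) by push_cast; ring,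
      recipPoch_natCast, recipPoch_natCast]
    ring
  · intro n hn
    refine ⟨n - r, Nat.sub_add_cancel ?_⟩
    by_contra hlt
    exact hn (by simp [recipPoch_of_neg (show (n : ℤ) - r < 0 by omega)])

theorem tsum_X_pow_sq_mul_recipPoch (r : ℤ) :
    ∑' n : ℕ, X ^ (n ^ 2) * (recipPoch (n - r) * recipPoch (n + r)) =
      qPow (r ^ 2) * recip qPochInf := by
  have hq : ∀ m : ℕ, qPow ((m : ℤ) ^ 2) = X ^ (m ^ 2) := fun m => by
    rw [qPow, ← Nat.cast_pow, Int.toNat_natCast]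
  obtain ⟨m, rfl | rfl⟩ := r.eq_nat_or_neg
  · rw [hq, tsum_X_pow_sq_mul_recipPoch_natCast]
  · rw [neg_sq, hq, ← tsum_X_pow_sq_mul_recipPoch_natCast]
    refine tsum_congr fun n => ?_
    rw [sub_neg_eq_add, ← sub_eq_add_neg, mul_comm (recipPoch _)]

/-! ### The Bailey pair with `β_n = 1 / (q; q)_(2n)` -/

theorem X_pow_natAbs_dvd_qPow {k e : ℤ} (h : |k| ≤ e) : X ^ k.natAbs ∣ qPow e :=
  pow_dvd_pow X (by rw [Int.abs_eq_natAbs] at h; omega)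

theorem abs_le_six_mul_sq_add (k : ℤ) : |k| ≤ 6 * k ^ 2 + k :=
  abs_le'.2 ⟨by nlinarith, by rcases le_or_gt 0 k with h | h <;> nlinarith⟩

theorem abs_le_six_mul_sq_add_five (k : ℤ) : |k| ≤ 6 * k ^ 2 + 5 * k + 1 := by
  rcases le_or_gt 0 k with h | h
  · rw [abs_of_nonneg h]; nlinarith
  · rw [abs_of_neg h]; nlinarith

theorem summable_qPow_fst_mul (f : ℤ → ℤ⟦X⟧) :
    Summable fun k : ℤ => qPow (6 * k ^ 2 + k) * f k :=
  summable_int_of_X_pow_dvd fun k =>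
    (X_pow_natAbs_dvd_qPow (abs_le_six_mul_sq_add k)).mul_right _

theorem summable_qPow_snd_mul (f : ℤ → ℤ⟦X⟧) :
    Summable fun k : ℤ => qPow (6 * k ^ 2 + 5 * k + 1) * f k :=
  summable_int_of_X_pow_dvd fun k =>
    (X_pow_natAbs_dvd_qPow (abs_le_six_mul_sq_add_five k)).mul_right _

/-- The alternating sum of the `1 / ((q; q)_(a-r) (q; q)_(b+r))` over `r = 3k` and `r = 3k + 1`,
with weights `q^(6k² + k)` and `-q^(6k² + 5k + 1)`. -/
noncomputable def baileySum (a b : ℤ) : ℤ⟦X⟧ :=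
  ∑' k : ℤ, qPow (6 * k ^ 2 + k) * (recipPoch (a - 3 * k) * recipPoch (b + 3 * k)) -
  ∑' k : ℤ, qPow (6 * k ^ 2 + 5 * k + 1) *
    (recipPoch (a - 3 * k - 1) * recipPoch (b + 3 * k + 1))

theorem baileySum_zero : baileySum 0 0 = 1 := by
  rw [baileySum, tsum_eq_single 0, tsum_eq_single 0]
  · simp [qPow, recipPoch, recip_qPoch_zero]
  · intro k _
    rcases lt_or_ge k 0 with h | h
    · rw [recipPoch_of_neg (show 0 + 3 * k + 1 < 0 by omega), mul_zero, mul_zero]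
    · rw [recipPoch_of_neg (show 0 - 3 * k - 1 < 0 by omega), zero_mul, mul_zero]
  · intro k hk
    rcases lt_or_gt_of_ne hk with h | h
    · rw [recipPoch_of_neg (show 0 + 3 * k < 0 by omega), mul_zero, mul_zero]
    · rw [recipPoch_of_neg (show 0 - 3 * k < 0 by omega), zero_mul, mul_zero]

/-- The q-Pascal recurrence splits each half in two; the unwanted parts of the two halves agree
after reindexing and cancel. -/
theorem one_sub_qPow_mul_baileySum_succ (n : ℤ) :
    (1 - qPow (2 * n + 1)) * baileySum n (n + 1) = baileySum n n := by
  have h1 : (1 - qPow (2 * n + 1)) *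
      ∑' k : ℤ, qPow (6 * k ^ 2 + k) * (recipPoch (n - 3 * k) * recipPoch (n + 1 + 3 * k)) =
      ∑' k : ℤ, qPow (6 * k ^ 2 + k) * (recipPoch (n - 3 * k) * recipPoch (n + 3 * k)) +
      ∑' k : ℤ, qPow (6 * k ^ 2 + k) * (qPow (n + 1 + 3 * k) *
        (recipPoch (n - 3 * k - 1) * recipPoch (n + 1 + 3 * k))) := by
    rw [← (summable_qPow_fst_mul _).tsum_mul_left,
      ← (summable_qPow_fst_mul _).tsum_add (summable_qPow_fst_mul _)]
    refine tsum_congr fun k => ?_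
    have h := one_sub_qPow_mul_recipPoch_mul (n - 3 * k) (n + 1 + 3 * k)
    rw [show n - 3 * k + (n + 1 + 3 * k) = 2 * n + 1 by ring,
      show n + 1 + 3 * k - 1 = n + 3 * k by ring] at h
    linear_combination qPow (6 * k ^ 2 + k) * h
  have h2 : (1 - qPow (2 * n + 1)) * ∑' k : ℤ, qPow (6 * k ^ 2 + 5 * k + 1) *
        (recipPoch (n - 3 * k - 1) * recipPoch (n + 1 + 3 * k + 1)) =
      ∑' k : ℤ, qPow (6 * k ^ 2 + 5 * k + 1) *
        (recipPoch (n - 3 * k - 1) * recipPoch (n + 3 * k + 1)) +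
      ∑' k : ℤ, qPow (6 * k ^ 2 + 5 * k + 1) * (qPow (n + 1 + 3 * k + 1) *
        (recipPoch (n - 3 * k - 1 - 1) * recipPoch (n + 1 + 3 * k + 1))) := by
    rw [← (summable_qPow_snd_mul _).tsum_mul_left,
      ← (summable_qPow_snd_mul _).tsum_add (summable_qPow_snd_mul _)]
    refine tsum_congr fun k => ?_
    have h := one_sub_qPow_mul_recipPoch_mul (n - 3 * k - 1) (n + 1 + 3 * k + 1)
    rw [show n - 3 * k - 1 + (n + 1 + 3 * k + 1) = 2 * n + 1 by ring,
      show n + 1 + 3 * k + 1 - 1 = n + 3 * k + 1 by ring] at h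
    linear_combination qPow (6 * k ^ 2 + 5 * k + 1) * h
  have h3 : ∑' k : ℤ, qPow (6 * k ^ 2 + k) * (qPow (n + 1 + 3 * k) *
        (recipPoch (n - 3 * k - 1) * recipPoch (n + 1 + 3 * k))) =
      ∑' k : ℤ, qPow (6 * k ^ 2 + 5 * k + 1) * (qPow (n + 1 + 3 * k + 1) *
        (recipPoch (n - 3 * k - 1 - 1) * recipPoch (n + 1 + 3 * k + 1))) := by
    -- The reflection k → -1-k swaps the two indices, and both total exponents equal 6k²+8k+n+3.
    rw [← (Equiv.subLeft (-1 : ℤ)).tsum_eq]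
    refine tsum_congr fun k => ?_
    have ha := (abs_nonneg _).trans (abs_le_six_mul_sq_add (-1 - k))
    have hb := (abs_nonneg _).trans (abs_le_six_mul_sq_add_five k)
    rw [Equiv.subLeft_apply]
    have e1 := qPow_mul_qPow_mul_recipPoch ha (n + 1 + 3 * (-1 - k))
    have e2 := qPow_mul_qPow_mul_recipPoch hb (n + 1 + 3 * k + 1)
    rw [show n + 1 + 3 * (-1 - k) = n - 3 * k - 1 - 1 by ring] at e1 ⊢
    rw [show n - 3 * (-1 - k) - 1 = n + 1 + 3 * k + 1 by ring]
    rw [show 6 * (-1 - k) ^ 2 + (-1 - k) + (n - 3 * k - 1 - 1) =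
      6 * k ^ 2 + 5 * k + 1 + (n + 1 + 3 * k + 1) by ring] at e1
    linear_combination recipPoch (n + 1 + 3 * k + 1) * e1 - recipPoch (n - 3 * k - 1 - 1) * e2
  rw [baileySum, baileySum, mul_sub, h1, h2, h3]
  ring

theorem one_sub_qPow_mul_baileySum_add_one (n : ℤ) :
    (1 - qPow (2 * n + 2)) * baileySum (n + 1) (n + 1) = baileySum n (n + 1) := by
  have h1 : (1 - qPow (2 * n + 2)) *
      ∑' k : ℤ, qPow (6 * k ^ 2 + k) * (recipPoch (n + 1 - 3 * k) * recipPoch (n + 1 + 3 * k)) =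
      ∑' k : ℤ, qPow (6 * k ^ 2 + k) * (recipPoch (n - 3 * k) * recipPoch (n + 1 + 3 * k)) +
      ∑' k : ℤ, qPow (6 * k ^ 2 + k) * (qPow (n + 1 - 3 * k) *
        (recipPoch (n + 3 * k) * recipPoch (n + 1 - 3 * k))) := by
    rw [← (summable_qPow_fst_mul _).tsum_mul_left,
      ← (summable_qPow_fst_mul _).tsum_add (summable_qPow_fst_mul _)]
    refine tsum_congr fun k => ?_
    -- The arguments are swapped relative to the previous half-step, so that the other index is
    -- lowered.
    have h := one_sub_qPow_mul_recipPoch_mul (n + 1 + 3 * k) (n + 1 - 3 * k)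
    rw [show n + 1 + 3 * k + (n + 1 - 3 * k) = 2 * n + 2 by ring,
      show n + 1 + 3 * k - 1 = n + 3 * k by ring,
      show n + 1 - 3 * k - 1 = n - 3 * k by ring] at h
    linear_combination qPow (6 * k ^ 2 + k) * h
  have h2 : (1 - qPow (2 * n + 2)) * ∑' k : ℤ, qPow (6 * k ^ 2 + 5 * k + 1) *
        (recipPoch (n + 1 - 3 * k - 1) * recipPoch (n + 1 + 3 * k + 1)) =
      ∑' k : ℤ, qPow (6 * k ^ 2 + 5 * k + 1) *
        (recipPoch (n - 3 * k - 1) * recipPoch (n + 1 + 3 * k + 1)) +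
      ∑' k : ℤ, qPow (6 * k ^ 2 + 5 * k + 1) * (qPow (n - 3 * k) *
        (recipPoch (n + 1 + 3 * k) * recipPoch (n - 3 * k))) := by
    rw [← (summable_qPow_snd_mul _).tsum_mul_left,
      ← (summable_qPow_snd_mul _).tsum_add (summable_qPow_snd_mul _)]
    refine tsum_congr fun k => ?_
    have h := one_sub_qPow_mul_recipPoch_mul (n + 1 + 3 * k + 1) (n - 3 * k)
    rw [show n + 1 + 3 * k + 1 + (n - 3 * k) = 2 * n + 2 by ring,
      show n + 1 + 3 * k + 1 - 1 = n + 1 + 3 * k by ring] at h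
    rw [show n + 1 - 3 * k - 1 = n - 3 * k by ring]
    linear_combination qPow (6 * k ^ 2 + 5 * k + 1) * h
  have h3 : ∑' k : ℤ, qPow (6 * k ^ 2 + k) * (qPow (n + 1 - 3 * k) *
        (recipPoch (n + 3 * k) * recipPoch (n + 1 - 3 * k))) =
      ∑' k : ℤ, qPow (6 * k ^ 2 + 5 * k + 1) * (qPow (n - 3 * k) *
        (recipPoch (n + 1 + 3 * k) * recipPoch (n - 3 * k))) := by
    -- Here k → -k matches the leftovers, with common exponent 6k²+2k+n+1.
    rw [← (Equiv.neg ℤ).tsum_eq]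
    refine tsum_congr fun k => ?_
    have ha := (abs_nonneg _).trans (abs_le_six_mul_sq_add (-k))
    have hb := (abs_nonneg _).trans (abs_le_six_mul_sq_add_five k)
    rw [Equiv.neg_apply]
    have e1 := qPow_mul_qPow_mul_recipPoch ha (n + 1 - 3 * (-k))
    have e2 := qPow_mul_qPow_mul_recipPoch hb (n - 3 * k)
    rw [show n + 1 - 3 * (-k) = n + 1 + 3 * k by ring] at e1 ⊢
    rw [show n + 3 * (-k) = n - 3 * k by ring]
    rw [show 6 * (-k) ^ 2 + (-k) + (n + 1 + 3 * k) =
      6 * k ^ 2 + 5 * k + 1 + (n - 3 * k) by ring] at e1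
    linear_combination recipPoch (n - 3 * k) * e1 - recipPoch (n + 1 + 3 * k) * e2
  rw [baileySum, baileySum, mul_sub, h1, h2, h3]
  ring

theorem baileySum_eq (n : ℕ) : baileySum n n = recip (qPoch (2 * n)) := by
  refine (recip_eq_of_mul_eq_one (constantCoeff_qPoch _) ?_).symm
  induction n with
  | zero => simp [baileySum_zero, qPoch]
  | succ n ih =>
    have h1 := one_sub_qPow_mul_baileySum_succ n
    have h2 := one_sub_qPow_mul_baileySum_add_one n
    rw [show 2 * (n : ℤ) + 1 = (2 * n + 1 : ℕ) by push_cast; ring, qPow, Int.toNat_natCast] at h1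
    rw [show 2 * (n : ℤ) + 2 = (2 * n + 2 : ℕ) by push_cast; ring, qPow, Int.toNat_natCast] at h2
    rw [show 2 * (n + 1) = 2 * n + 1 + 1 by ring, qPoch_succ, qPoch_succ, mul_assoc, Nat.cast_succ,
      h2, mul_assoc, h1, ih]

/-! ### The identity -/

theorem summable_X_pow_sq_mul_prod (c : ℤ → ℤ⟦X⟧) (hc : ∀ k, X ^ k.natAbs ∣ c k)
    (f : ℕ → ℤ → ℤ⟦X⟧) :
    Summable (Function.uncurry fun (n : ℕ) (k : ℤ) => X ^ (n ^ 2) * (c k * f n k)) := by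
  refine summable_nat_prod_int_of_X_pow_dvd fun p => ?_
  rw [Function.uncurry_def, pow_add]
  exact mul_dvd_mul (pow_dvd_pow X (Nat.le_self_pow two_ne_zero _)) ((hc p.2).mul_right _)

/-- The interchange is legitimate because q^(n²) forces growing order in n and `hc` does so in k,
giving joint summability. -/
theorem tsum_X_pow_sq_mul_tsum (c : ℤ → ℤ⟦X⟧) (hc : ∀ k, X ^ k.natAbs ∣ c k) (r : ℤ → ℤ) :
    ∑' n : ℕ, X ^ (n ^ 2) * ∑' k : ℤ, c k * (recipPoch (n - r k) * recipPoch (n + r k)) =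
      ∑' k : ℤ, c k * qPow (r k ^ 2) * recip qPochInf := by
  have hsum : ∀ n : ℕ, Summable fun k : ℤ =>
      c k * (recipPoch (n - r k) * recipPoch (n + r k)) := fun n =>
    summable_int_of_X_pow_dvd fun k => (hc k).mul_right _
  have hsum' : ∀ k : ℤ, Summable fun n : ℕ =>
      (X : ℤ⟦X⟧) ^ (n ^ 2) * (recipPoch (n - r k) * recipPoch (n + r k)) := fun k => by
    simpa using summable_X_pow_sq_mul 0 fun n => recipPoch (n - r k) * recipPoch (n + r k)
  have hcomm := Summable.tsum_comm' (summable_X_pow_sq_mul_prod c hc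
    fun n k => recipPoch (n - r k) * recipPoch (n + r k))
    (fun n => (hsum n).mul_left _)
    (fun k => ((hsum' k).mul_left (c k)).congr fun n => by ring)
  rw [tsum_congr fun n : ℕ => ((hsum n).tsum_mul_left (X ^ (n ^ 2))).symm, ← hcomm]
  refine tsum_congr fun k => ?_
  rw [mul_assoc, ← tsum_X_pow_sq_mul_recipPoch, ← (hsum' k).tsum_mul_left]
  exact tsum_congr fun n => by ring

theorem corollary5p1 :
    (Summable fun n : ℕ => (X : ℤ⟦X⟧) ^ (n ^ 2) * recip (qPoch (2 * n))) ∧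
    (Summable fun k : ℤ => qPow (15 * k ^ 2 + k) - qPow (15 * k ^ 2 + 11 * k + 2)) ∧
    (∑' n : ℕ, (X : ℤ⟦X⟧) ^ (n ^ 2) * recip (qPoch (2 * n))) =
      recip qPochInf *
        ∑' k : ℤ, (qPow (15 * k ^ 2 + k) - qPow (15 * k ^ 2 + 11 * k + 2)) := by
  have hA : ∀ k : ℤ, qPow (6 * k ^ 2 + k) * qPow ((3 * k) ^ 2) = qPow (15 * k ^ 2 + k) :=
    fun k => by
      rw [← qPow_add ((abs_nonneg _).trans (abs_le_six_mul_sq_add k)) (sq_nonneg _)]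
      ring_nf
  have hB : ∀ k : ℤ, qPow (6 * k ^ 2 + 5 * k + 1) * qPow ((3 * k + 1) ^ 2) =
      qPow (15 * k ^ 2 + 11 * k + 2) := fun k => by
    rw [← qPow_add ((abs_nonneg _).trans (abs_le_six_mul_sq_add_five k)) (sq_nonneg _)]
    ring_nf
  have sA : Summable fun k : ℤ => qPow (15 * k ^ 2 + k) :=
    (summable_qPow_fst_mul _).congr fun k => hA k
  have sB : Summable fun k : ℤ => qPow (15 * k ^ 2 + 11 * k + 2) :=
    (summable_qPow_snd_mul _).congr fun k => hB k
  refine ⟨by simpa using summable_X_pow_sq_mul 0 fun n => recip (qPoch (2 * n)), sA.sub sB, ?_⟩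
  have h1 := tsum_X_pow_sq_mul_tsum (fun k => qPow (6 * k ^ 2 + k))
    (fun k => X_pow_natAbs_dvd_qPow (abs_le_six_mul_sq_add k)) fun k => 3 * k
  have h2 := tsum_X_pow_sq_mul_tsum (fun k => qPow (6 * k ^ 2 + 5 * k + 1))
    (fun k => X_pow_natAbs_dvd_qPow (abs_le_six_mul_sq_add_five k)) fun k => 3 * k + 1
  simp only [hA, hB, sA.tsum_mul_right, sB.tsum_mul_right] at h1 h2
  have s : ∀ f : ℕ → ℤ⟦X⟧, Summable fun n : ℕ => X ^ (n ^ 2) * f n := fun f => by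
    simpa using summable_X_pow_sq_mul 0 f
  rw [sA.tsum_sub sB, mul_sub, mul_comm (recip _), mul_comm (recip _), ← h1, ← h2,
    ← (s _).tsum_sub (s _)]
  refine tsum_congr fun n => ?_
  rw [← baileySum_eq, baileySum, mul_sub]
  simp only [← sub_sub, ← add_assoc]
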